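/- For each $n\ge 1$ let $\theta_n\in(0,1]$ (the sequence $(\theta_n)$ is arbitrary), and let $\pi_n(x)=\theta_n^{S(x)}(1+\theta_n)^{-n}$ on $\{0,1\}^n$, where $S(x)=\sum_i x_i$ is the number of ones of $x$. The lazy random walk Metropolis chain for $\pi_n$ stays at its current state $x$ with probability $1/2$; otherwise it picks one of the $n$ states $y$ that differ from $x$ in exactly one coordinate, uniformly at random, and moves to $y$ with probability $\min(1,\pi_n(y)/\pi_n(x))$, remaining at $x$ if the move is rejected. Let $P_n$ be its transition matrix, $d_n(t)=\max_x\|P_n^t(x,\cdot)-\pi_n\|_{TV}$ its worst-case total variation distance to stationarity, and $t^{(n)}_{\rm mix}(\varepsilon)=\min\{t\ge 0: d_n(t)\le\varepsilon\}$ (with $d_n(s)=d_n(\lfloor \max(s,0)\rfloor)$ for real $s$). Then this sequence of chains has cutoff at $$t_n=\frac{2}{1+\theta_n}\,n\,\min\Big\{\log n,\ \log\sqrt{n/\theta_n}\Big\}$$ with a window of size $n$. That is, for every $\varepsilon\in(0,1)$, $$\lim_{n\to\infty}\frac{t^{(n)}_{\rm mix}(\varepsilon)}{t^{(n)}_{\rm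 mix}(1-\varepsilon)}=1,$$ and, both for $\tau_n=t_n$ and for $\tau_n=t^{(n)}_{\rm mix}(1/4)$, one has $n=o(\tau_n)$, $$\lim_{\alpha\to\infty}\liminf_{n\to\infty}d_n(\tau_n-\alpha n)=1,\qquad \lim_{\alpha\to\infty}\limsup_{n\to\infty}d_n(\tau_n+\alpha n)=0 .$$ -/

import Mathlib

open Filter Topology Asymptotics

noncomputable section

namespace MetropolisCutoff

/-- The hypercube `{0,1}^n`. -/
abbrev Cube (n : ℕ) : Type := Fin n → Bool

/-- `S(x)`, the number of ones in `x`. -/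
def numOnes {n : ℕ} (x : Cube n) : ℕ := (Finset.univ.filter fun i => x i = true).card

/-- Off-diagonal step of the random walk Metropolis algorithm for `π`: from `x` a uniformly chosen
neighbour `y` (Hamming distance one) is proposed and accepted with probability
`min (1, π y / π x)`. -/
def moveProb {n : ℕ} (π : Cube n → ℝ) (x y : Cube n) : ℝ :=
  if hammingDist x y = 1 then (1 / (n : ℝ)) * min 1 (π y / π x) else 0

/-- Transition matrix of the (non-lazy) random walk Metropolis algorithm for `π`: a rejected
proposal leaves the chain where it is. -/
def metropolis {n : ℕ} (π : Cube n → ℝ) : Matrix (Cube n) (Cube n) ℝ :=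
  Matrix.of fun x y => if x = y then 1 - ∑ z, moveProb π x z else moveProb π x y

/-- The lazy version of a transition matrix: stay put with probability `1/2`, otherwise move
according to `P`. -/
def lazyVersion {Ω : Type*} [DecidableEq Ω] (P : Matrix Ω Ω ℝ) : Matrix Ω Ω ℝ :=
  (1 / 2 : ℝ) • (1 : Matrix Ω Ω ℝ) + (1 / 2 : ℝ) • P

/-- Total variation distance `max_A (μ(A) - ν(A))` of two probability vectors on a finite set. -/
def tvDist {Ω : Type*} [Fintype Ω] (μ ν : Ω → ℝ) : ℝ :=
  ⨆ A : Finset Ω, (∑ x ∈ A, μ x - ∑ x ∈ A, ν x)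

/-- `d(t) = max_x ‖P^t(x,·) - π‖_TV`, for the transition matrix `P` and the distribution `π`. -/
def worstDist {Ω : Type*} [Fintype Ω] [DecidableEq Ω] (P : Matrix Ω Ω ℝ) (π : Ω → ℝ)
    (t : ℕ) : ℝ :=
  ⨆ x : Ω, tvDist (fun y => (P ^ t) x y) π

/-- `t_mix(ε) = min {t ≥ 0 : d(t) ≤ ε}`. -/
def mixingTime (d : ℕ → ℝ) (ε : ℝ) : ℕ := sInf {t : ℕ | d t ≤ ε}

/-- Cutoff of a sequence of chains, where `d n t` is the worst-case distance to stationarity of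
the `n`-th chain at time `t`. -/
def HasCutoff (d : ℕ → ℕ → ℝ) : Prop :=
  ∀ ε : ℝ, 0 < ε → ε < 1 →
    Tendsto (fun n => (mixingTime (d n) ε : ℝ) / (mixingTime (d n) (1 - ε) : ℝ)) atTop (𝓝 1)

/-- The sequence of chains makes its transition around the times `τ n` with window size `w n`.
Real times are rounded down (and negative ones replaced by `0`). -/
def HasCutoffWindow (d : ℕ → ℕ → ℝ) (τ w : ℕ → ℝ) : Prop :=
  w =o[atTop] τ ∧
  Tendsto (fun α : ℝ => liminf (fun n => d n ⌊τ n - α * w n⌋₊) atTop) atTop (𝓝 1) ∧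
  Tendsto (fun α : ℝ => limsup (fun n => d n ⌊τ n + α * w n⌋₊) atTop) atTop (𝓝 0)

/-- The distribution `π(x) = θ^{S(x)} (1+θ)^{-n}` on `{0,1}^n`. -/
def erMeasure (n : ℕ) (θ : ℝ) (x : Cube n) : ℝ := θ ^ numOnes x * ((1 + θ) ^ n)⁻¹

/-- `d_n(t)` for the lazy random walk Metropolis chain for `π(x) = θ^{S(x)} (1+θ)^{-n}`. -/
def erDist (n : ℕ) (θ : ℝ) (t : ℕ) : ℝ :=
  worstDist (lazyVersion (metropolis (erMeasure n θ))) (erMeasure n θ) t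

end MetropolisCutoff

end

/-!
Flipping a zero is accepted with probability `θ` and flipping a one always, so the chain updates a
uniformly chosen coordinate by a two-state chain with eigenvalues `1` and `(1 - θ) / 2`
(`erChain_mulVec`). Products of the one-coordinate eigenfunctions over `k` coordinates are
eigenfunctions with eigenvalue `1 - (1 + θ) k / (2 n)` (`erChain_mulVec_mode`), and they resolve the
identity, which gives the spectral formula `erChain_pow_apply`. Write `λ = 1 - (1 + θ) / (2 n)`.

*Upper bounds.* One step multiplies the largest change of a function under a single flip by at most
`λ`, hence `d(t) ≤ n λ ^ t` (`erDist_le_mul_modeEigenvalue_pow`), which is small after `log n` units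
of relaxation time `2 n / (1 + θ)`. The `L²` distance is a return probability, and summing the
spectral formula gives `d(t) ≤ √(exp((n / θ) exp(-(1 + θ) t / n)) - 1)` (`erDist_le_sqrt`), which is
small after `log √(n / θ)` units. The minimum in the cutoff time is the better of the two.

*Lower bound.* Started from all ones, the sum of the first-order eigenfunctions has mean `n λ ^ t`,
against mean zero in equilibrium. The coordinates are negatively correlated because the second-order
eigenvalue is at most `λ ^ 2`, so the two variances add up to at most `2 n θ + n λ ^ t`. Chebyshev's
inequality (`le_erDist`) separates the laws as long as `n λ ^ t` is large compared with both `1` and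
`√(n θ)`, that is, up to the minimum of the two times.

Thus the distance drops from near `1` to near `0` within a multiple of `n` around the cutoff time
(`linearTransition_erDist`), uniformly in the sequence `θ`. As the distance is nonincreasing and the
cutoff time is at least of order `n log n`, every mixing time is within a multiple of `n` of it, and
all the assertions follow.
-/

noncomputable section

namespace MetropolisCutoff

/-! ### The chain as a random-coordinate update -/

/-- The state `x` with its `i`-th coordinate flipped. -/
def flipAt {n : ℕ} (x : Cube n) (i : Fin n) : Cube n := Function.update x i (!x i)

/-- The probability that the Metropolis rule accepts a flip of a coordinate whose current value is
`b`: ones are always removed, zeros are turned into ones with probability `θ`. -/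
def acceptProb (θ : ℝ) (b : Bool) : ℝ := if b then 1 else θ

/-- The marginal of `erMeasure` in one coordinate. -/
def bitWeight (θ : ℝ) (b : Bool) : ℝ := (if b then θ else 1) * (1 + θ)⁻¹

/-- The transition matrix of the lazy random walk Metropolis chain for `erMeasure n θ`. -/
abbrev erChain (n : ℕ) (θ : ℝ) : Matrix (Cube n) (Cube n) ℝ :=
  lazyVersion (metropolis (erMeasure n θ))

variable {n : ℕ} {θ : ℝ}

lemma flipAt_apply_self (x : Cube n) (i : Fin n) : flipAt x i i = !x i := by
  simp [flipAt]

lemma flipAt_apply_of_ne (x : Cube n) {i j : Fin n} (h : j ≠ i) : flipAt x i j = x j := by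
  simp [flipAt, h]

lemma flipAt_flipAt (x : Cube n) (i : Fin n) : flipAt (flipAt x i) i = x := by
  simp [flipAt]

lemma flipAt_comm (x : Cube n) (i j : Fin n) :
    flipAt (flipAt x i) j = flipAt (flipAt x j) i := by
  by_cases h : i = j
  · rw [h]
  · rw [flipAt, flipAt_apply_of_ne x (Ne.symm h), flipAt, flipAt, flipAt_apply_of_ne x h,
      flipAt, Function.update_comm h]

lemma flipAt_injective (x : Cube n) : Function.Injective (flipAt x) := by
  intro i j h
  by_contra hij
  have := congrFun h i
  rw [flipAt_apply_self, flipAt_apply_of_ne x hij] at this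
  simp at this

lemma hammingDist_flipAt (x : Cube n) (i : Fin n) : hammingDist x (flipAt x i) = 1 := by
  rw [hammingDist, Finset.card_eq_one]
  refine ⟨i, ?_⟩
  ext j
  by_cases h : j = i
  · subst h; simp [flipAt_apply_self]
  · simp [flipAt_apply_of_ne x h, h]

lemma exists_eq_flipAt {x z : Cube n} (h : hammingDist x z = 1) : ∃ i, flipAt x i = z := by
  rw [hammingDist, Finset.card_eq_one] at h
  obtain ⟨i, hi⟩ := h
  refine ⟨i, ?_⟩
  ext1 j
  have hj := Finset.ext_iff.1 hi j
  simp only [Finset.mem_filter, Finset.mem_univ, true_and, Finset.mem_singleton] at hj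
  by_cases hji : j = i
  · subst hji
    rw [flipAt_apply_self]
    have := hj.2 rfl
    revert this
    cases x j <;> cases z j <;> simp
  · rw [flipAt_apply_of_ne x hji]
    by_contra hne
    exact hji (hj.1 hne)

lemma erMeasure_eq_prod (x : Cube n) : erMeasure n θ x = ∏ i, bitWeight θ (x i) := by
  simp only [bitWeight, Finset.prod_mul_distrib, erMeasure, numOnes, Finset.prod_const,
    Finset.card_univ, Fintype.card_fin, inv_pow]
  congr 1
  rw [← Finset.prod_filter, Finset.prod_const]

lemma bitWeight_pos (hθ : 0 < θ) (b : Bool) : 0 < bitWeight θ b := by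
  unfold bitWeight; split_ifs <;> positivity

lemma erMeasure_pos (hθ : 0 < θ) (x : Cube n) : 0 < erMeasure n θ x := by
  rw [erMeasure_eq_prod]
  exact Finset.prod_pos fun i _ => bitWeight_pos hθ _

lemma sum_erMeasure (hθ : 0 < θ) : ∑ x : Cube n, erMeasure n θ x = 1 := by
  simp only [erMeasure_eq_prod]
  have h := Finset.prod_univ_sum (fun _ : Fin n => (Finset.univ : Finset Bool))
    (fun _ b => bitWeight θ b)
  rw [Fintype.piFinset_univ] at h
  rw [← h]
  refine Finset.prod_eq_one fun i _ => ?_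
  simp only [Fintype.sum_bool, bitWeight]
  have : (1 + θ) ≠ 0 := by positivity
  field_simp
  simp [add_comm]

lemma erMeasure_flipAt (x : Cube n) (i : Fin n) :
    erMeasure n θ (flipAt x i) * bitWeight θ (x i) = erMeasure n θ x * bitWeight θ (!x i) := by
  simp only [erMeasure_eq_prod]
  rw [← Finset.mul_prod_erase Finset.univ (fun j => bitWeight θ (flipAt x i j)) (Finset.mem_univ i),
    ← Finset.mul_prod_erase Finset.univ (fun j => bitWeight θ (x j)) (Finset.mem_univ i),
    flipAt_apply_self, Finset.prod_congr rfl (g := fun j => bitWeight θ (x j))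
      (fun j hj => by rw [flipAt_apply_of_ne x (Finset.ne_of_mem_erase hj)])]
  ring

lemma min_erMeasure_flipAt (hθ : 0 < θ) (hθ1 : θ ≤ 1) (x : Cube n) (i : Fin n) :
    min 1 (erMeasure n θ (flipAt x i) / erMeasure n θ x) = acceptProb θ (x i) := by
  have h1 : erMeasure n θ (flipAt x i) / erMeasure n θ x
      = bitWeight θ (!x i) / bitWeight θ (x i) := by
    rw [div_eq_div_iff (erMeasure_pos hθ x).ne' (bitWeight_pos hθ _).ne', erMeasure_flipAt,
      mul_comm]
  have h2 : (1 + θ) ≠ 0 := by positivity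
  rw [h1]
  cases x i
  · have : bitWeight θ (!false) / bitWeight θ false = θ := by
      simp [bitWeight]; field_simp
    rw [this, min_eq_right hθ1]; simp [acceptProb]
  · have : bitWeight θ (!true) / bitWeight θ true = 1 / θ := by
      simp [bitWeight]; field_simp
    rw [this, min_eq_left ((one_le_div hθ).2 hθ1)]; simp [acceptProb]

lemma sum_moveProb_mul (hθ : 0 < θ) (hθ1 : θ ≤ 1) (x : Cube n) (h : Cube n → ℝ) :
    ∑ z, moveProb (erMeasure n θ) x z * h z
      = 1 / (n : ℝ) * ∑ i, acceptProb θ (x i) * h (flipAt x i) := by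
  rw [Finset.mul_sum]
  symm
  refine Finset.sum_of_injOn (flipAt x) (flipAt_injective x).injOn (by simp) ?_ ?_
  · intro z _ hz
    rw [moveProb, if_neg, zero_mul]
    intro hd
    obtain ⟨i, hi⟩ := exists_eq_flipAt hd
    exact hz ⟨i, by simp, hi⟩
  · intro i _
    rw [moveProb, if_pos (hammingDist_flipAt x i), min_erMeasure_flipAt hθ hθ1]
    ring

/-- One step of the chain: a uniformly chosen coordinate is flipped with probability
`acceptProb / 2`. -/
lemma erChain_mulVec (hθ : 0 < θ) (hθ1 : θ ≤ 1) (h : Cube n → ℝ) (x : Cube n) :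
    (erChain n θ).mulVec h x
      = h x + 1 / (2 * (n : ℝ)) * ∑ i, acceptProb θ (x i) * (h (flipAt x i) - h x) := by
  have hs := sum_moveProb_mul hθ hθ1 x h
  have hs1 := sum_moveProb_mul hθ hθ1 x (fun _ => 1)
  simp only [mul_one] at hs1
  have hentry : ∀ y, erChain n θ x y * h y
      = (if x = y then h y else 0)
        + 1 / 2 * (moveProb (erMeasure n θ) x y * h y)
        - 1 / 2 * (if x = y then (∑ z, moveProb (erMeasure n θ) x z) * h y else 0) := by
    intro y
    simp only [erChain, lazyVersion, metropolis, Matrix.add_apply, Matrix.smul_apply,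
      Matrix.one_apply, Matrix.of_apply, smul_eq_mul]
    split_ifs with hxy
    · subst hxy
      have : moveProb (erMeasure n θ) x x = 0 := by simp [moveProb]
      rw [this]; ring
    · ring
  rw [Matrix.mulVec, dotProduct]
  simp only [hentry]
  rw [Finset.sum_sub_distrib, Finset.sum_add_distrib, ← Finset.mul_sum, ← Finset.mul_sum, hs]
  simp only [Finset.sum_ite_eq, Finset.mem_univ, if_true]
  rw [hs1]
  simp only [mul_sub, Finset.sum_sub_distrib, ← Finset.sum_mul]
  ring

lemma acceptProb_nonneg (hθ : 0 < θ) (b : Bool) : 0 ≤ acceptProb θ b := by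
  unfold acceptProb; split_ifs <;> positivity

lemma acceptProb_le_one (hθ1 : θ ≤ 1) (b : Bool) : acceptProb θ b ≤ 1 := by
  unfold acceptProb; split_ifs <;> simp [hθ1]

lemma acceptProb_add_not (b : Bool) : acceptProb θ b + acceptProb θ (!b) = 1 + θ := by
  cases b <;> simp [acceptProb, add_comm]

lemma erChain_nonneg (hθ : 0 < θ) (hθ1 : θ ≤ 1) (x y : Cube n) : 0 ≤ erChain n θ x y := by
  have hmove : ∀ z, 0 ≤ moveProb (erMeasure n θ) x z := by
    intro z
    unfold moveProb
    split_ifs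
    · have := (erMeasure_pos (n := n) hθ x).le
      have := (erMeasure_pos (n := n) hθ z).le
      positivity
    · rfl
  have hsum : ∑ z, moveProb (erMeasure n θ) x z ≤ 1 := by
    have hs1 := sum_moveProb_mul hθ hθ1 x (fun _ => 1)
    simp only [mul_one] at hs1
    rw [hs1]
    have : ∑ i, acceptProb θ (x i) ≤ n := by
      calc _ ≤ ∑ i : Fin n, (1 : ℝ) := Finset.sum_le_sum fun i _ => acceptProb_le_one hθ1 _
        _ = n := by simp
    calc _ ≤ 1 / (n : ℝ) * n := by gcongr
      _ ≤ 1 := by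
        rw [one_div]; exact inv_mul_le_one
  simp only [erChain, lazyVersion, metropolis, Matrix.add_apply, Matrix.smul_apply,
      Matrix.one_apply, Matrix.of_apply, smul_eq_mul]
  split_ifs
  · linarith
  · have := hmove y; linarith

lemma erChain_pow_nonneg (hθ : 0 < θ) (hθ1 : θ ≤ 1) (t : ℕ) (x y : Cube n) :
    0 ≤ (erChain n θ ^ t) x y := by
  induction t generalizing x with
  | zero => rw [pow_zero, Matrix.one_apply]; split_ifs <;> norm_num
  | succ t ih =>
    rw [pow_succ', Matrix.mul_apply]
    exact Finset.sum_nonneg fun z _ => mul_nonneg (erChain_nonneg hθ hθ1 x z) (ih z)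

lemma erChain_pow_row_sum (hθ : 0 < θ) (hθ1 : θ ≤ 1) (t : ℕ) (x : Cube n) :
    ∑ y, (erChain n θ ^ t) x y = 1 := by
  have h : (erChain n θ ^ t).mulVec (fun _ => 1) = fun _ => 1 := by
    induction t with
    | zero => simp
    | succ t ih =>
      rw [pow_succ', ← Matrix.mulVec_mulVec, ih]
      ext x
      rw [erChain_mulVec hθ hθ1]
      simp
  simpa [Matrix.mulVec, dotProduct] using congrFun h x

/-! ### Product eigenfunctions -/

/-- The nonconstant eigenfunction of the single-coordinate chain, normalised to be `1` at the
value one. -/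
def bitMode (θ : ℝ) (b : Bool) : ℝ := if b then 1 else -θ

/-- The product eigenfunction of the chain supported on the set of coordinates `A`. -/
def mode (θ : ℝ) (A : Finset (Fin n)) (x : Cube n) : ℝ := ∏ i ∈ A, bitMode θ (x i)

/-- The eigenvalue of the product eigenfunctions supported on `k` coordinates. -/
def modeEigenvalue (n : ℕ) (θ : ℝ) (k : ℕ) : ℝ := 1 - (1 + θ) * k / (2 * n)

lemma erChain_mulVec_mode (hθ : 0 < θ) (hθ1 : θ ≤ 1) (A : Finset (Fin n)) :
    (erChain n θ).mulVec (mode θ A) = modeEigenvalue n θ A.card • mode θ A := by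
  ext x
  rw [erChain_mulVec hθ hθ1, Pi.smul_apply, smul_eq_mul]
  have hterm : ∀ i, acceptProb θ (x i) * (mode θ A (flipAt x i) - mode θ A x)
      = if i ∈ A then -(1 + θ) * mode θ A x else 0 := by
    intro i
    split_ifs with hi
    · unfold mode
      rw [← Finset.mul_prod_erase A (fun j => bitMode θ (flipAt x i j)) hi,
        ← Finset.mul_prod_erase A (fun j => bitMode θ (x j)) hi, flipAt_apply_self,
        Finset.prod_congr rfl (g := fun j => bitMode θ (x j))
          (fun j hj => by rw [flipAt_apply_of_ne x (Finset.ne_of_mem_erase hj)])]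
      cases x i <;> simp [bitMode, acceptProb] <;> ring
    · unfold mode
      rw [Finset.prod_congr rfl (g := fun j => bitMode θ (x j))
          (fun j hj => by rw [flipAt_apply_of_ne x (ne_of_mem_of_not_mem hj hi)]), sub_self, mul_zero]
  simp only [hterm]
  rw [Finset.sum_ite_mem, Finset.univ_inter, Finset.sum_const, nsmul_eq_mul, modeEigenvalue]
  ring

lemma erChain_pow_mulVec_mode (hθ : 0 < θ) (hθ1 : θ ≤ 1) (A : Finset (Fin n)) (t : ℕ) :
    (erChain n θ ^ t).mulVec (mode θ A) = modeEigenvalue n θ A.card ^ t • mode θ A := by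
  induction t with
  | zero => simp
  | succ t ih =>
    rw [pow_succ', ← Matrix.mulVec_mulVec, ih, Matrix.mulVec_smul, erChain_mulVec_mode hθ hθ1,
      smul_smul, pow_succ]

/-- The product eigenfunctions are complete: they resolve the identity. -/
lemma one_eq_sum_mode (hθ : 0 < θ) (x y : Cube n) :
    (1 : Matrix (Cube n) (Cube n) ℝ) x y
      = erMeasure n θ y * ∑ A : Finset (Fin n), (θ ^ A.card)⁻¹ * mode θ A y * mode θ A x := by
  have h1 : ∀ A : Finset (Fin n), (θ ^ A.card)⁻¹ * mode θ A y * mode θ A x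
      = ∏ i ∈ A, θ⁻¹ * bitMode θ (y i) * bitMode θ (x i) := by
    intro A
    simp only [mode, Finset.prod_mul_distrib, Finset.prod_const, inv_pow]
  simp only [h1]
  have h2 := Finset.prod_one_add (R := ℝ) (f := fun i => θ⁻¹ * bitMode θ (y i) * bitMode θ (x i))
    (Finset.univ : Finset (Fin n))
  rw [Finset.powerset_univ] at h2
  rw [← h2, erMeasure_eq_prod, ← Finset.prod_mul_distrib]
  have h3 : ∀ i, bitWeight θ (y i) * (1 + θ⁻¹ * bitMode θ (y i) * bitMode θ (x i))
      = if x i = y i then 1 else 0 := by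
    intro i
    have : (1 + θ) ≠ 0 := by positivity
    cases x i <;> cases y i <;> simp only [bitMode, bitWeight, reduceCtorEq,
      if_true, if_false] <;> field_simp <;> ring
  simp only [h3]
  rw [Matrix.one_apply, Finset.prod_boole]
  simp [funext_iff]

/-- The spectral formula for the transition probabilities. -/
lemma erChain_pow_apply (hθ : 0 < θ) (hθ1 : θ ≤ 1) (t : ℕ) (x y : Cube n) :
    (erChain n θ ^ t) x y = erMeasure n θ y * ∑ A : Finset (Fin n),
      modeEigenvalue n θ A.card ^ t * (θ ^ A.card)⁻¹ * mode θ A y * mode θ A x := by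
  have h : (erChain n θ ^ t) x y
      = (erChain n θ ^ t).mulVec (fun z => (1 : Matrix (Cube n) (Cube n) ℝ) z y) x := by
    have := congrFun (congrFun (mul_one (erChain n θ ^ t)) x) y
    rw [← this, Matrix.mul_apply]; rfl
  rw [h]
  simp only [one_eq_sum_mode hθ, Matrix.mulVec, dotProduct, Finset.mul_sum]
  rw [Finset.sum_comm]
  refine Finset.sum_congr rfl fun A _ => ?_
  have h2 := congrFun (erChain_pow_mulVec_mode hθ hθ1 A t) x
  simp only [Matrix.mulVec, dotProduct, Pi.smul_apply, smul_eq_mul] at h2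
  calc _ = erMeasure n θ y * (θ ^ A.card)⁻¹ * mode θ A y
        * ∑ z, (erChain n θ ^ t) x z * mode θ A z := by
        rw [Finset.mul_sum]; exact Finset.sum_congr rfl fun z _ => by ring
    _ = _ := by rw [h2]; ring

lemma erChain_pow_reversible (hθ : 0 < θ) (hθ1 : θ ≤ 1) (t : ℕ) (x y : Cube n) :
    erMeasure n θ x * (erChain n θ ^ t) x y = erMeasure n θ y * (erChain n θ ^ t) y x := by
  rw [erChain_pow_apply hθ hθ1, erChain_pow_apply hθ hθ1, mul_left_comm]
  congr 2
  exact Finset.sum_congr rfl fun A _ => by ring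

lemma modeEigenvalue_nonneg (hθ1 : θ ≤ 1) {k : ℕ} (hk : k ≤ n) :
    0 ≤ modeEigenvalue n θ k := by
  unfold modeEigenvalue
  have hk' : (k : ℝ) ≤ n := by exact_mod_cast hk
  rw [sub_nonneg]
  refine div_le_one_of_le₀ ?_ (by positivity)
  nlinarith [(Nat.cast_nonneg k : (0 : ℝ) ≤ k)]

lemma modeEigenvalue_pow_le_exp (hθ1 : θ ≤ 1) {k : ℕ} (hk : k ≤ n) (t : ℕ) :
    modeEigenvalue n θ k ^ t ≤ Real.exp (-((1 + θ) * k * t / (2 * n))) := by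
  calc _ ≤ Real.exp (-((1 + θ) * k / (2 * n))) ^ t := by
        refine pow_le_pow_left₀ (modeEigenvalue_nonneg hθ1 hk) ?_ t
        have := Real.add_one_le_exp (-((1 + θ) * k / (2 * n)))
        unfold modeEigenvalue
        linarith
    _ = _ := by
      rw [← Real.exp_nat_mul]; congr 1; ring

lemma sum_erMeasure_mul_mode (hn : 0 < n) (hθ : 0 < θ) (hθ1 : θ ≤ 1) {A : Finset (Fin n)}
    (hA : A.Nonempty) : ∑ x, erMeasure n θ x * mode θ A x = 0 := by
  -- stationarity shows that the mean is multiplied by the eigenvalue, which is less than one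
  have h : ∑ x, erMeasure n θ x * mode θ A x
      = modeEigenvalue n θ A.card * ∑ x, erMeasure n θ x * mode θ A x := by
    calc ∑ x, erMeasure n θ x * mode θ A x
        = ∑ x, (∑ y, erMeasure n θ x * (erChain n θ ^ 1) x y) * mode θ A x := by
          simp_rw [← Finset.mul_sum, erChain_pow_row_sum hθ hθ1, mul_one]
      _ = ∑ x, ∑ y, erMeasure n θ y * ((erChain n θ ^ 1) y x * mode θ A x) := by
          refine Finset.sum_congr rfl fun x _ => ?_
          rw [Finset.sum_mul]
          exact Finset.sum_congr rfl fun y _ => by rw [erChain_pow_reversible hθ hθ1]; ring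
      _ = ∑ y, erMeasure n θ y * (erChain n θ).mulVec (mode θ A) y := by
          rw [Finset.sum_comm, pow_one]
          simp only [Matrix.mulVec, dotProduct, Finset.mul_sum]
      _ = _ := by
          rw [erChain_mulVec_mode hθ hθ1, Finset.mul_sum]
          exact Finset.sum_congr rfl fun y _ => by
            rw [Pi.smul_apply, smul_eq_mul]; ring
  have hlt : modeEigenvalue n θ A.card < 1 := by
    have : (0 : ℝ) < A.card := by exact_mod_cast hA.card_pos
    have : (0 : ℝ) < n := by exact_mod_cast hn
    unfold modeEigenvalue
    have : 0 < (1 + θ) * A.card / (2 * n) := by positivity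
    linarith
  by_contra hne
  have : modeEigenvalue n θ A.card = 1 := by
    apply mul_right_cancel₀ hne; rw [← h, one_mul]
  exact hlt.ne this

/-! ### Total variation distance -/

section TotalVariation

variable {Ω : Type*} [Fintype Ω]

lemma sub_le_tvDist (μ ν : Ω → ℝ) (A : Finset Ω) :
    ∑ x ∈ A, μ x - ∑ x ∈ A, ν x ≤ tvDist μ ν :=
  le_ciSup (f := fun A : Finset Ω => ∑ x ∈ A, μ x - ∑ x ∈ A, ν x)
    (Set.finite_range _).bddAbove A

lemma tvDist_le {μ ν : Ω → ℝ} {b : ℝ}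
    (h : ∀ A : Finset Ω, ∑ x ∈ A, μ x - ∑ x ∈ A, ν x ≤ b) : tvDist μ ν ≤ b :=
  ciSup_le h

lemma tvDist_nonneg (μ ν : Ω → ℝ) : 0 ≤ tvDist μ ν := by
  simpa using sub_le_tvDist μ ν ∅

lemma tvDist_le_worstDist [DecidableEq Ω] (P : Matrix Ω Ω ℝ) (π : Ω → ℝ) (t : ℕ) (x : Ω) :
    tvDist (fun y => (P ^ t) x y) π ≤ worstDist P π t :=
  le_ciSup (f := fun x => tvDist (fun y => (P ^ t) x y) π) (Set.finite_range _).bddAbove x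

/-- A function whose means under `μ` and `ν` are `m` and `0` distinguishes the two distributions
if its variances are small compared with `m ^ 2`. -/
lemma one_sub_le_tvDist_of_variance {μ ν : Ω → ℝ} (hμ : ∀ x, 0 ≤ μ x) (hν : ∀ x, 0 ≤ ν x)
    (hμ1 : ∑ x, μ x = 1) (F : Ω → ℝ) {m V W : ℝ} (hm : 0 < m)
    (hV : ∑ x, μ x * (F x - m) ^ 2 ≤ V) (hW : ∑ x, ν x * F x ^ 2 ≤ W) :
    1 - 4 * (V + W) / m ^ 2 ≤ tvDist μ ν := by
  classical
  set A := Finset.univ.filter fun x => m / 2 ≤ F x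
  have h1 : ∑ x ∈ A, ν x * (m ^ 2 / 4) ≤ W := by
    refine le_trans ?_ hW
    refine le_trans (Finset.sum_le_sum (g := fun x => ν x * F x ^ 2) fun x hx => ?_)
      (Finset.sum_le_sum_of_subset_of_nonneg (Finset.subset_univ A)
        fun x _ _ => mul_nonneg (hν x) (sq_nonneg _))
    have hx' : m / 2 ≤ F x := (Finset.mem_filter.1 hx).2
    exact mul_le_mul_of_nonneg_left (by nlinarith) (hν x)
  have h2 : ∑ x ∈ Aᶜ, μ x * (m ^ 2 / 4) ≤ V := by
    refine le_trans ?_ hV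
    refine le_trans (Finset.sum_le_sum (g := fun x => μ x * (F x - m) ^ 2) fun x hx => ?_)
      (Finset.sum_le_sum_of_subset_of_nonneg (Finset.subset_univ Aᶜ)
        fun x _ _ => mul_nonneg (hμ x) (sq_nonneg _))
    have hx' : F x < m / 2 := by
      by_contra h
      exact (Finset.mem_compl.1 hx) (Finset.mem_filter.2 ⟨Finset.mem_univ x, not_lt.1 h⟩)
    exact mul_le_mul_of_nonneg_left (by nlinarith) (hμ x)
  rw [← Finset.sum_mul] at h1 h2
  have h3 := Finset.sum_add_sum_compl A μ
  refine le_trans ?_ (sub_le_tvDist μ ν A)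
  have h4 : 4 * (V + W) / m ^ 2 ≥ ∑ x ∈ Aᶜ, μ x + ∑ x ∈ A, ν x := by
    rw [ge_iff_le, le_div_iff₀ (by positivity)]
    linarith
  linarith

end TotalVariation

lemma erDist_le {t : ℕ} {b : ℝ} (h : ∀ (x : Cube n) (A : Finset (Cube n)),
    ∑ y ∈ A, (erChain n θ ^ t) x y - ∑ y ∈ A, erMeasure n θ y ≤ b) : erDist n θ t ≤ b :=
  ciSup_le fun x => tvDist_le (h x)

lemma tvDist_le_erDist (t : ℕ) (x : Cube n) :
    tvDist (fun y => (erChain n θ ^ t) x y) (erMeasure n θ) ≤ erDist n θ t :=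
  tvDist_le_worstDist _ _ t x

lemma erDist_nonneg (t : ℕ) : 0 ≤ erDist n θ t :=
  (tvDist_nonneg _ _).trans (tvDist_le_erDist t fun _ => true)

lemma erDist_le_one (hθ : 0 < θ) (hθ1 : θ ≤ 1) (t : ℕ) : erDist n θ t ≤ 1 := by
  refine erDist_le fun x A => ?_
  have h1 : ∑ y ∈ A, (erChain n θ ^ t) x y ≤ ∑ y, (erChain n θ ^ t) x y :=
    Finset.sum_le_sum_of_subset_of_nonneg (Finset.subset_univ A)
      fun y _ _ => erChain_pow_nonneg hθ hθ1 t x y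
  rw [erChain_pow_row_sum hθ hθ1] at h1
  have h2 : 0 ≤ ∑ y ∈ A, erMeasure n θ y := Finset.sum_nonneg fun y _ => (erMeasure_pos hθ y).le
  linarith

lemma erDist_antitone (hθ : 0 < θ) (hθ1 : θ ≤ 1) : Antitone (erDist n θ) := by
  refine antitone_nat_of_succ_le fun t => erDist_le fun x A => ?_
  have hrow : ∑ z, erChain n θ x z = 1 := by simpa using erChain_pow_row_sum hθ hθ1 1 x
  calc ∑ y ∈ A, (erChain n θ ^ (t + 1)) x y - ∑ y ∈ A, erMeasure n θ y
      = ∑ z, erChain n θ x z * (∑ y ∈ A, (erChain n θ ^ t) z y - ∑ y ∈ A, erMeasure n θ y) := by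
        simp only [pow_succ', Matrix.mul_apply, mul_sub, Finset.sum_sub_distrib, ← Finset.sum_mul,
          hrow, one_mul]
        rw [Finset.sum_comm]
        simp only [Finset.mul_sum]
    _ ≤ ∑ z, erChain n θ x z * erDist n θ t :=
        Finset.sum_le_sum fun z _ => mul_le_mul_of_nonneg_left
          ((sub_le_tvDist _ _ A).trans (tvDist_le_erDist t z)) (erChain_nonneg hθ hθ1 x z)
    _ = erDist n θ t := by rw [← Finset.sum_mul, hrow, one_mul]

/-! ### Upper bound by contraction of oscillations -/

/-- One step contracts the largest change of a function under a single flip. The two flip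
probabilities of a coordinate add up to `(1 + θ) / 2`, so the chosen coordinate contributes the
factor `(1 - θ) / 2`. -/
lemma abs_erChain_mulVec_flipAt_sub_le (hn : 0 < n) (hθ : 0 < θ) (hθ1 : θ ≤ 1)
    {h : Cube n → ℝ} {c : ℝ} (hc : ∀ x j, |h (flipAt x j) - h x| ≤ c) (x : Cube n) (j : Fin n) :
    |(erChain n θ).mulVec h (flipAt x j) - (erChain n θ).mulVec h x|
      ≤ modeEigenvalue n θ 1 * c := by
  have hn' : (n : ℝ) ≠ 0 := by positivity
  have hc0 : 0 ≤ c := (abs_nonneg _).trans (hc x j)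
  -- the chain as an average over the updated coordinate
  have havg : ∀ y, (erChain n θ).mulVec h y
      = 1 / (n : ℝ) * ∑ i, (h y + acceptProb θ (y i) / 2 * (h (flipAt y i) - h y)) := by
    intro y
    rw [erChain_mulVec hθ hθ1, Finset.sum_add_distrib, Finset.sum_const, Finset.card_univ,
      Fintype.card_fin, nsmul_eq_mul, mul_add, ← mul_assoc, one_div_mul_cancel hn', one_mul,
      Finset.mul_sum, Finset.mul_sum]
    congr 1
    exact Finset.sum_congr rfl fun i _ => by field_simp
  have hterm : ∀ i, |(h (flipAt x j) + acceptProb θ (flipAt x j i) / 2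
        * (h (flipAt (flipAt x j) i) - h (flipAt x j)))
      - (h x + acceptProb θ (x i) / 2 * (h (flipAt x i) - h x))|
      ≤ c - if i = j then (1 + θ) / 2 * c else 0 := by
    intro i
    split_ifs with hij
    · subst hij
      have hsum := acceptProb_add_not (θ := θ) (x i)
      rw [flipAt_apply_self, flipAt_flipAt]
      have : (h (flipAt x i) + acceptProb θ (!x i) / 2 * (h x - h (flipAt x i)))
          - (h x + acceptProb θ (x i) / 2 * (h (flipAt x i) - h x))
          = (1 - (1 + θ) / 2) * (h (flipAt x i) - h x) := by
        rw [← hsum]; ring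
      rw [this, abs_mul, abs_of_nonneg (by linarith)]
      calc _ ≤ (1 - (1 + θ) / 2) * c :=
            mul_le_mul_of_nonneg_left (hc x i) (by linarith)
        _ = _ := by ring
    · rw [flipAt_apply_of_ne x hij, flipAt_comm x j i, sub_zero]
      have ha0 := acceptProb_nonneg hθ (x i)
      have ha1 := acceptProb_le_one hθ1 (x i)
      have : (h (flipAt x j) + acceptProb θ (x i) / 2
            * (h (flipAt (flipAt x i) j) - h (flipAt x j)))
          - (h x + acceptProb θ (x i) / 2 * (h (flipAt x i) - h x))
          = (1 - acceptProb θ (x i) / 2) * (h (flipAt x j) - h x)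
            + acceptProb θ (x i) / 2 * (h (flipAt (flipAt x i) j) - h (flipAt x i)) := by ring
      rw [this]
      refine (abs_add_le _ _).trans ?_
      rw [abs_mul, abs_mul, abs_of_nonneg (by linarith : 0 ≤ 1 - acceptProb θ (x i) / 2),
        abs_of_nonneg (by linarith : 0 ≤ acceptProb θ (x i) / 2)]
      have e1 := mul_le_mul_of_nonneg_left (hc x j)
        (by linarith : 0 ≤ 1 - acceptProb θ (x i) / 2)
      have e2 := mul_le_mul_of_nonneg_left (hc (flipAt x i) j)
        (by linarith : 0 ≤ acceptProb θ (x i) / 2)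
      linarith
  rw [havg, havg, ← mul_sub, ← Finset.sum_sub_distrib, abs_mul, abs_of_nonneg (by positivity)]
  calc _ ≤ 1 / (n : ℝ) * ∑ i : Fin n, (c - if i = j then (1 + θ) / 2 * c else 0) := by
        refine mul_le_mul_of_nonneg_left ?_ (by positivity)
        exact (Finset.abs_sum_le_sum_abs _ _).trans (Finset.sum_le_sum fun i _ => hterm i)
    _ = _ := by
        rw [Finset.sum_sub_distrib, Finset.sum_const, Finset.sum_ite_eq']
        simp only [Finset.card_univ, Fintype.card_fin, nsmul_eq_mul, Finset.mem_univ, if_true,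
          modeEigenvalue]
        push_cast
        field_simp

lemma abs_sub_le_of_flipAt {h : Cube n → ℝ} {c : ℝ} (hc : ∀ x j, |h (flipAt x j) - h x| ≤ c)
    (x y : Cube n) : |h y - h x| ≤ n * c := by
  have key : ∀ S : Finset (Fin n), |h (S.piecewise y x) - h x| ≤ S.card * c := by
    intro S
    induction S using Finset.induction_on with
    | empty => simp
    | insert i S hi ih =>
      have hstep : |h ((insert i S).piecewise y x) - h (S.piecewise y x)| ≤ c := by
        rw [Finset.piecewise_insert]
        set z := S.piecewise y x
        by_cases hz : z i = y i
        · rw [← hz, Function.update_eq_self, sub_self, abs_zero]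
          exact (abs_nonneg _).trans (hc x i)
        · have : y i = !z i := by
            revert hz; cases z i <;> cases y i <;> simp
          rw [this]
          exact hc z i
      rw [Finset.card_insert_of_notMem hi]
      push_cast
      calc _ ≤ |h ((insert i S).piecewise y x) - h (S.piecewise y x)|
            + |h (S.piecewise y x) - h x| := abs_sub_le _ _ _
        _ ≤ c + S.card * c := add_le_add hstep ih
        _ = _ := by ring
  simpa using key Finset.univ

lemma erDist_le_mul_modeEigenvalue_pow (hn : 0 < n) (hθ : 0 < θ) (hθ1 : θ ≤ 1) (t : ℕ) :
    erDist n θ t ≤ n * modeEigenvalue n θ 1 ^ t := by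
  refine erDist_le fun x A => ?_
  set g : Cube n → ℝ := fun y => if y ∈ A then 1 else 0
  have hosc : ∀ s x j, |(erChain n θ ^ s).mulVec g (flipAt x j) - (erChain n θ ^ s).mulVec g x|
      ≤ modeEigenvalue n θ 1 ^ s := by
    intro s
    induction s with
    | zero =>
      intro x j
      simp only [pow_zero, Matrix.one_mulVec, g]
      split_ifs <;> norm_num
    | succ s ih =>
      intro x j
      rw [pow_succ', ← Matrix.mulVec_mulVec, pow_succ']
      exact abs_erChain_mulVec_flipAt_sub_le hn hθ hθ1 ih x j
  have hg : ∀ z, (erChain n θ ^ t).mulVec g z = ∑ y ∈ A, (erChain n θ ^ t) z y := by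
    intro z
    simp [Matrix.mulVec, dotProduct, g]
  -- by stationarity the mass of `A` is an average of transition probabilities
  have hstat : ∑ y ∈ A, erMeasure n θ y
      = ∑ z, erMeasure n θ z * (erChain n θ ^ t).mulVec g z := by
    simp only [hg, Finset.mul_sum]
    rw [Finset.sum_comm]
    refine Finset.sum_congr rfl fun y _ => ?_
    simp only [fun z => erChain_pow_reversible hθ hθ1 t z y]
    rw [← Finset.mul_sum, erChain_pow_row_sum hθ hθ1, mul_one]
  calc ∑ y ∈ A, (erChain n θ ^ t) x y - ∑ y ∈ A, erMeasure n θ y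
      = ∑ z, erMeasure n θ z
          * ((erChain n θ ^ t).mulVec g x - (erChain n θ ^ t).mulVec g z) := by
        simp only [mul_sub, Finset.sum_sub_distrib]
        rw [← Finset.sum_mul, sum_erMeasure hθ, one_mul, ← hstat, hg]
    _ ≤ ∑ z, erMeasure n θ z * (n * modeEigenvalue n θ 1 ^ t) :=
        Finset.sum_le_sum fun z _ => mul_le_mul_of_nonneg_left
          ((le_abs_self _).trans (abs_sub_le_of_flipAt (hosc t) z x)) (erMeasure_pos hθ z).le
    _ = _ := by rw [← Finset.sum_mul, sum_erMeasure hθ, one_mul]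

/-! ### Upper bound by the spectrum -/

lemma mode_sq_le_one (hθ : 0 < θ) (hθ1 : θ ≤ 1) (A : Finset (Fin n)) (x : Cube n) :
    mode θ A x * mode θ A x ≤ 1 := by
  rw [mode, ← Finset.prod_mul_distrib]
  refine Finset.prod_le_one (fun i _ => mul_self_nonneg _) fun i _ => ?_
  unfold bitMode
  split_ifs <;> nlinarith

/-- The bound on the diagonal transition probabilities given by the spectral formula. -/
lemma erChain_pow_diag_le (hθ : 0 < θ) (hθ1 : θ ≤ 1) (t : ℕ) (x : Cube n) :
    (erChain n θ ^ (t + t)) x x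
      ≤ erMeasure n θ x * Real.exp (n / θ * Real.exp (-((1 + θ) * t / n))) := by
  rw [erChain_pow_apply hθ hθ1]
  refine mul_le_mul_of_nonneg_left ?_ (erMeasure_pos hθ x).le
  set q := θ⁻¹ * Real.exp (-((1 + θ) * t / n))
  have hq : 0 ≤ q := by positivity
  have hbound : ∀ A : Finset (Fin n), modeEigenvalue n θ A.card ^ (t + t) * (θ ^ A.card)⁻¹
      * mode θ A x * mode θ A x ≤ ∏ i ∈ A, q := by
    intro A
    have hA : A.card ≤ n := by simpa using Finset.card_le_univ A
    have h1 := modeEigenvalue_pow_le_exp hθ1 hA (t + t)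
    have h0 := pow_nonneg (modeEigenvalue_nonneg hθ1 hA) (t + t)
    have h2 := mode_sq_le_one hθ hθ1 A x
    have h3 : (0 : ℝ) ≤ (θ ^ A.card)⁻¹ := by positivity
    rw [Finset.prod_const, mul_pow, ← Real.exp_nat_mul, inv_pow, mul_assoc _ (mode θ A x)]
    have h4 : Real.exp (-((1 + θ) * A.card * ((t + t : ℕ) : ℝ) / (2 * n)))
        = Real.exp (A.card * -((1 + θ) * t / n)) := by
      congr 1; push_cast; ring
    rw [h4] at h1
    calc _ ≤ modeEigenvalue n θ A.card ^ (t + t) * (θ ^ A.card)⁻¹ * 1 := by gcongr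
      _ ≤ Real.exp (A.card * -((1 + θ) * t / n)) * (θ ^ A.card)⁻¹ * 1 := by gcongr
      _ = _ := by ring
  calc _ ≤ ∑ A : Finset (Fin n), ∏ i ∈ A, q := Finset.sum_le_sum fun A _ => hbound A
    _ = (1 + q) ^ n := by
        have h := Finset.prod_one_add (f := fun _ : Fin n => q) (Finset.univ : Finset (Fin n))
        rw [Finset.powerset_univ] at h
        rw [← h]; simp
    _ ≤ Real.exp q ^ n := by
        have := Real.add_one_le_exp q
        gcongr; linarith
    _ = _ := by
        rw [← Real.exp_nat_mul]; congr 1; simp only [q]; ring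

/-- The `L²` bound: the squared `L²` distance to stationarity at time `t` is governed by the return
probability at time `2t`. -/
lemma erDist_le_sqrt (hθ : 0 < θ) (hθ1 : θ ≤ 1) (t : ℕ) :
    erDist n θ t
      ≤ √(Real.exp (n / θ * Real.exp (-((1 + θ) * t / n))) - 1) := by
  refine erDist_le fun x A => Real.le_sqrt_of_sq_le ?_
  set p : Cube n → ℝ := fun y => (erChain n θ ^ t) x y
  set w : Cube n → ℝ := erMeasure n θ
  have hw : ∀ y, 0 < w y := fun y => erMeasure_pos hθ y
  have hchi : ∑ y, (p y - w y) ^ 2 / w y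
      ≤ Real.exp (n / θ * Real.exp (-((1 + θ) * t / n))) - 1 := by
    have h1 : ∑ y, p y ^ 2 / w y = (erChain n θ ^ (t + t)) x x / w x := by
      rw [pow_add, Matrix.mul_apply, Finset.sum_div]
      refine Finset.sum_congr rfl fun y _ => ?_
      have := erChain_pow_reversible hθ hθ1 t x y
      rw [div_eq_div_iff (hw y).ne' (hw x).ne']
      linear_combination p y * this
    have h2 : ∀ y, (p y - w y) ^ 2 / w y = p y ^ 2 / w y - 2 * p y + w y := by
      intro y
      have := (hw y).ne'
      field_simp
      ring
    simp only [h2, Finset.sum_add_distrib, Finset.sum_sub_distrib, ← Finset.mul_sum]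
    rw [h1, erChain_pow_row_sum hθ hθ1, sum_erMeasure hθ]
    have h3 : (erChain n θ ^ (t + t)) x x / w x
        ≤ Real.exp (n / θ * Real.exp (-((1 + θ) * t / n))) := by
      rw [div_le_iff₀' (hw x)]
      exact erChain_pow_diag_le hθ hθ1 t x
    linarith
  refine le_trans ?_ hchi
  have hcs := Finset.sum_sq_le_sum_mul_sum_of_sq_le_mul A (r := fun y => p y - w y) (f := w)
    (g := fun y => (p y - w y) ^ 2 / w y) (fun y _ => (hw y).le)
    (fun y _ => div_nonneg (sq_nonneg _) (hw y).le)
    (fun y _ => (mul_div_cancel₀ _ (hw y).ne').ge)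
  rw [← Finset.sum_sub_distrib]
  have hA1 : ∑ y ∈ A, w y ≤ 1 := by
    rw [← sum_erMeasure (n := n) hθ]
    exact Finset.sum_le_sum_of_subset_of_nonneg (Finset.subset_univ A) fun y _ _ => (hw y).le
  have hA2 : ∑ y ∈ A, (p y - w y) ^ 2 / w y ≤ ∑ y, (p y - w y) ^ 2 / w y :=
    Finset.sum_le_sum_of_subset_of_nonneg (Finset.subset_univ A)
      fun y _ _ => div_nonneg (sq_nonneg _) (hw y).le
  have hA3 : 0 ≤ ∑ y ∈ A, (p y - w y) ^ 2 / w y :=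
    Finset.sum_nonneg fun y _ => div_nonneg (sq_nonneg _) (hw y).le
  calc _ ≤ _ := hcs
    _ ≤ 1 * ∑ y ∈ A, (p y - w y) ^ 2 / w y := by gcongr
    _ ≤ _ := by rw [one_mul]; exact hA2

/-! ### Lower bound by the sum of the first-order eigenfunctions -/

/-- The sum of the eigenfunctions with one active coordinate; it equals `(1 + θ) S - n θ`. -/
def linearStat (θ : ℝ) (x : Cube n) : ℝ := ∑ i, bitMode θ (x i)

/-- The second moment of the linear statistic only involves modes with at most two active
coordinates. -/
lemma linearStat_sq (x : Cube n) :
    linearStat θ x ^ 2 = n * θ + (1 - θ) * ∑ i, mode θ {i} x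
      + ∑ i, ∑ j ∈ Finset.univ.erase i, mode θ {i, j} x := by
  have hdiag : ∀ b, bitMode θ b * bitMode θ b = θ + (1 - θ) * bitMode θ b := by
    intro b; cases b <;> simp [bitMode]; ring
  have hrow : ∀ i, bitMode θ (x i) * ∑ j, bitMode θ (x j)
      = θ + (1 - θ) * mode θ {i} x + ∑ j ∈ Finset.univ.erase i, mode θ {i, j} x := by
    intro i
    rw [← Finset.add_sum_erase _ _ (Finset.mem_univ i), mul_add, hdiag, Finset.mul_sum]
    congr 1
    · simp [mode]
    · refine Finset.sum_congr rfl fun j hj => ?_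
      rw [mode, Finset.prod_pair (Finset.ne_of_mem_erase hj).symm]
  rw [linearStat, sq, Finset.sum_mul]
  simp only [hrow, Finset.sum_add_distrib, Finset.sum_const, Finset.card_univ, Fintype.card_fin,
    nsmul_eq_mul, Finset.mul_sum]

lemma linearStat_eq (x : Cube n) : linearStat θ x = ∑ i, mode θ {i} x := by
  simp [linearStat, mode]

/-- The second-order eigenvalue is at most the square of the first-order one, so the coordinates
are negatively correlated. -/
lemma modeEigenvalue_two_le : modeEigenvalue n θ 2 ≤ modeEigenvalue n θ 1 ^ 2 := by
  have h : modeEigenvalue n θ 1 ^ 2 - modeEigenvalue n θ 2 = ((1 + θ) / (2 * n)) ^ 2 := by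
    unfold modeEigenvalue; push_cast; ring
  nlinarith [sq_nonneg ((1 + θ) / (2 * n))]

lemma le_erDist (hn : 0 < n) (hθ : 0 < θ) (hθ1 : θ ≤ 1) (t : ℕ)
    (hpos : 0 < modeEigenvalue n θ 1) :
    1 - 4 * (2 * n * θ + n * modeEigenvalue n θ 1 ^ t) / (n * modeEigenvalue n θ 1 ^ t) ^ 2
      ≤ erDist n θ t := by
  set a := modeEigenvalue n θ 1 ^ t
  have ha : 0 < a := pow_pos hpos t
  have hn' : (0 : ℝ) < n := by exact_mod_cast hn
  set o : Cube n := fun _ => true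
  set p : Cube n → ℝ := fun y => (erChain n θ ^ t) o y
  have hp1 : ∑ y, p y = 1 := erChain_pow_row_sum hθ hθ1 t o
  have hmode : ∀ A : Finset (Fin n), ∑ y, p y * mode θ A y = modeEigenvalue n θ A.card ^ t := by
    intro A
    have := congrFun (erChain_pow_mulVec_mode hθ hθ1 A t) o
    rw [Pi.smul_apply, smul_eq_mul] at this
    have ho : mode θ A o = 1 := by simp [mode, bitMode, o]
    rw [ho, mul_one] at this
    exact this
  have hmean : ∑ y, p y * linearStat θ y = n * a := by
    simp only [linearStat_eq, Finset.mul_sum]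
    rw [Finset.sum_comm]
    simp [hmode, a]
  have hsq : ∀ w : Cube n → ℝ, ∑ y, w y = 1 → ∑ y, w y * linearStat θ y ^ 2
      = n * θ + (1 - θ) * ∑ i, ∑ y, w y * mode θ {i} y
        + ∑ i, ∑ j ∈ Finset.univ.erase i, ∑ y, w y * mode θ {i, j} y := by
    intro w hw
    simp only [linearStat_sq, mul_add, Finset.sum_add_distrib]
    rw [← Finset.sum_mul, hw, one_mul]
    congr 1
    · congr 1
      rw [Finset.mul_sum]
      simp only [Finset.mul_sum]
      rw [Finset.sum_comm]
      exact Finset.sum_congr rfl fun i _ => Finset.sum_congr rfl fun y _ => by ring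
    · simp only [Finset.mul_sum]
      rw [Finset.sum_comm]
      exact Finset.sum_congr rfl fun i _ => Finset.sum_comm
  have hV : ∑ y, p y * (linearStat θ y - n * a) ^ 2 ≤ n * θ + n * a := by
    have h2 : ∑ y, p y * (linearStat θ y - n * a) ^ 2
        = ∑ y, p y * linearStat θ y ^ 2 - (n * a) ^ 2 := by
      have : ∀ y, p y * (linearStat θ y - n * a) ^ 2 = p y * linearStat θ y ^ 2
          - 2 * (n * a) * (p y * linearStat θ y) + (n * a) ^ 2 * p y := fun y => by ring
      simp only [this, Finset.sum_add_distrib, Finset.sum_sub_distrib, ← Finset.mul_sum]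
      rw [hmean, hp1]; ring
    have h3 : ∑ i : Fin n, ∑ j ∈ Finset.univ.erase i, ∑ y, p y * mode θ {i, j} y
        ≤ (n * a) ^ 2 := by
      have hpair : ∀ i : Fin n, ∀ j ∈ Finset.univ.erase i,
          ∑ y, p y * mode θ {i, j} y ≤ a ^ 2 := by
        intro i j hj
        have hij : i ≠ j := (Finset.ne_of_mem_erase hj).symm
        have hle : 2 ≤ n := by
          have := Finset.card_le_univ ({i, j} : Finset (Fin n))
          rwa [Finset.card_pair hij, Fintype.card_fin] at this
        rw [hmode, Finset.card_pair hij, ← pow_mul, mul_comm t 2, pow_mul]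
        exact pow_le_pow_left₀ (modeEigenvalue_nonneg hθ1 hle) modeEigenvalue_two_le t
      calc _ ≤ ∑ i : Fin n, ∑ j ∈ Finset.univ.erase i, a ^ 2 :=
            Finset.sum_le_sum fun i _ => Finset.sum_le_sum (hpair i)
        _ ≤ ∑ i : Fin n, ∑ j : Fin n, a ^ 2 := Finset.sum_le_sum fun i _ =>
            Finset.sum_le_sum_of_subset_of_nonneg (Finset.erase_subset _ _)
              fun _ _ _ => sq_nonneg a
        _ = _ := by simp; ring
    rw [h2, hsq p hp1]
    simp only [hmode, Finset.card_singleton] at h3 ⊢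
    have h4 : ∑ i : Fin n, modeEigenvalue n θ 1 ^ t = n * a := by simp [a]
    rw [h4]
    nlinarith [mul_pos (mul_pos hn' ha) hθ]
  have hW : ∑ y, erMeasure n θ y * linearStat θ y ^ 2 ≤ n * θ := by
    rw [hsq _ (sum_erMeasure hθ)]
    simp only [sum_erMeasure_mul_mode hn hθ hθ1 (Finset.singleton_nonempty _),
      sum_erMeasure_mul_mode hn hθ hθ1 (Finset.insert_nonempty _ _)]
    simp
  refine le_trans (le_of_eq ?_) ((one_sub_le_tvDist_of_variance
    (fun y => erChain_pow_nonneg hθ hθ1 t o y) (fun y => (erMeasure_pos hθ y).le) hp1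
    (linearStat θ) (mul_pos hn' ha) hV hW).trans (tvDist_le_erDist t o))
  congr 2
  ring

/-! ### Cutoff from a transition of linear width -/

/-- The distances `d n` drop from near `1` to near `0` around the times `τ n`, within a multiple
of `n` that depends only on the accuracy. -/
def LinearTransition (d : ℕ → ℕ → ℝ) (τ : ℕ → ℝ) : Prop :=
  ∀ ε : ℝ, 0 < ε → ∃ C : ℝ, ∀ᶠ n in atTop,
    1 - ε ≤ d n ⌊τ n - C * n⌋₊ ∧ d n ⌊τ n + C * n⌋₊ ≤ ε

section Abstract

variable {d : ℕ → ℕ → ℝ} {τ σ : ℕ → ℝ}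

lemma LinearTransition.exists_forall_ge (hd : ∀ᶠ n in atTop, Antitone (d n))
    (h : LinearTransition d τ) {ε : ℝ} (hε : 0 < ε) :
    ∃ C : ℝ, ∀ α ≥ C, ∀ᶠ n in atTop,
      1 - ε ≤ d n ⌊τ n - α * n⌋₊ ∧ d n ⌊τ n + α * n⌋₊ ≤ ε := by
  obtain ⟨C, hC⟩ := h ε hε
  refine ⟨C, fun α hα => ?_⟩
  filter_upwards [hC, hd] with n hn hdn
  have : C * n ≤ α * n := mul_le_mul_of_nonneg_right hα n.cast_nonneg
  exact ⟨hn.1.trans (hdn (Nat.floor_mono (by linarith))),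
    (hdn (Nat.floor_mono (by linarith))).trans hn.2⟩

lemma LinearTransition.congr (hd : ∀ᶠ n in atTop, Antitone (d n)) (h : LinearTransition d τ)
    {C : ℝ} (hC : ∀ᶠ n in atTop, |σ n - τ n| ≤ C * n) : LinearTransition d σ := by
  intro ε hε
  obtain ⟨D, hD⟩ := h ε hε
  refine ⟨D + C, ?_⟩
  filter_upwards [hD, hd, hC] with n hn hdn hCn
  have := abs_le.1 hCn
  exact ⟨hn.1.trans (hdn (Nat.floor_mono (by linarith))),
    (hdn (Nat.floor_mono (by linarith))).trans hn.2⟩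

lemma tendsto_div_atTop_of_abs_sub_le (hτ : Tendsto (fun n => τ n / n) atTop atTop) {C : ℝ}
    (hC : ∀ᶠ n in atTop, |σ n - τ n| ≤ C * n) : Tendsto (fun n => σ n / n) atTop atTop := by
  refine tendsto_atTop_mono' _ ?_ (tendsto_atTop_add_const_right _ (-C) hτ)
  filter_upwards [hC, eventually_gt_atTop 0] with n hn h0
  have h0' : (0 : ℝ) < n := by exact_mod_cast h0
  have := abs_le.1 hn
  rw [le_div_iff₀ h0', add_mul, div_mul_cancel₀ _ h0'.ne']
  linarith

lemma isLittleO_of_tendsto_div_atTop (hτ : Tendsto (fun n => τ n / n) atTop atTop) :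
    (fun n : ℕ => (n : ℝ)) =o[atTop] τ := by
  refine (isLittleO_iff_tendsto' ?_).2 ?_
  · filter_upwards [hτ.eventually_gt_atTop 0] with n hn h0
    rw [h0, zero_div] at hn
    exact absurd hn (lt_irrefl _)
  · refine hτ.inv_tendsto_atTop.congr fun n => ?_
    simp

lemma LinearTransition.hasCutoffWindow (hd : ∀ᶠ n in atTop, Antitone (d n))
    (hd0 : ∀ᶠ n in atTop, ∀ t, 0 ≤ d n t) (hd1 : ∀ᶠ n in atTop, ∀ t, d n t ≤ 1)
    (h : LinearTransition d τ) (hτ : Tendsto (fun n => τ n / n) atTop atTop) :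
    HasCutoffWindow d τ (fun n => (n : ℝ)) := by
  have hlow : ∀ s : ℕ → ℕ, IsBoundedUnder (· ≥ ·) atTop fun n => d n (s n) :=
    fun s => isBoundedUnder_of_eventually_ge (hd0.mono fun n hn => hn (s n))
  have hupp : ∀ s : ℕ → ℕ, IsBoundedUnder (· ≤ ·) atTop fun n => d n (s n) :=
    fun s => isBoundedUnder_of_eventually_le (hd1.mono fun n hn => hn (s n))
  refine ⟨isLittleO_of_tendsto_div_atTop hτ, ?_, ?_⟩
  · refine Metric.tendsto_atTop.2 fun ε hε => ?_
    obtain ⟨C, hC⟩ := h.exists_forall_ge hd (half_pos hε)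
    refine ⟨C, fun α hα => ?_⟩
    have h1 : 1 - ε / 2 ≤ liminf (fun n => d n ⌊τ n - α * n⌋₊) atTop :=
      le_liminf_of_le (hupp _).isCoboundedUnder_ge ((hC α hα).mono fun n hn => hn.1)
    have h2 : liminf (fun n => d n ⌊τ n - α * n⌋₊) atTop ≤ 1 :=
      liminf_le_of_frequently_le (hd1.mono fun n hn => hn _).frequently (hlow _)
    rw [Real.dist_eq, abs_lt]
    constructor <;> linarith
  · refine Metric.tendsto_atTop.2 fun ε hε => ?_
    obtain ⟨C, hC⟩ := h.exists_forall_ge hd (half_pos hε)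
    refine ⟨C, fun α hα => ?_⟩
    have h1 : limsup (fun n => d n ⌊τ n + α * n⌋₊) atTop ≤ ε / 2 :=
      limsup_le_of_le (hlow _).isCoboundedUnder_le ((hC α hα).mono fun n hn => hn.2)
    have h2 : 0 ≤ limsup (fun n => d n ⌊τ n + α * n⌋₊) atTop :=
      le_limsup_of_frequently_le (hd0.mono fun n hn => hn _).frequently (hupp _)
    rw [Real.dist_eq, abs_lt]
    constructor <;> linarith

lemma LinearTransition.abs_mixingTime_sub_le (hd : ∀ᶠ n in atTop, Antitone (d n))
    (h : LinearTransition d τ) (hτ : Tendsto (fun n => τ n / n) atTop atTop) {ε : ℝ}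
    (hε0 : 0 < ε) (hε1 : ε < 1) :
    ∃ C : ℝ, ∀ᶠ n in atTop, |(mixingTime (d n) ε : ℝ) - τ n| ≤ C * n := by
  have hδ : 0 < min ε (1 - ε) / 2 := half_pos (lt_min hε0 (by linarith))
  obtain ⟨C, hC⟩ := h.exists_forall_ge hd hδ
  refine ⟨max C 0, ?_⟩
  filter_upwards [hC _ (le_max_left C 0), hd, hτ.eventually_gt_atTop 0, eventually_gt_atTop 0]
    with n hn hdn hτn h0
  have h0' : (0 : ℝ) < n := by exact_mod_cast h0
  have hτ0 : 0 < τ n := (div_pos_iff_of_pos_right h0').1 hτn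
  have hC0 : 0 ≤ max C 0 * n := mul_nonneg (le_max_right _ _) h0'.le
  have hδ1 : min ε (1 - ε) / 2 ≤ ε := by linarith [min_le_left ε (1 - ε)]
  have hδ2 : ε < 1 - min ε (1 - ε) / 2 := by linarith [min_le_right ε (1 - ε)]
  have hmem : ⌊τ n + max C 0 * n⌋₊ ∈ {t : ℕ | d n t ≤ ε} := hn.2.trans hδ1
  have hmix : d n (mixingTime (d n) ε) ≤ ε := Nat.sInf_mem ⟨_, hmem⟩
  have hup : (mixingTime (d n) ε : ℝ) ≤ τ n + max C 0 * n :=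
    (Nat.cast_le.2 (Nat.sInf_le hmem)).trans (Nat.floor_le (by linarith))
  have hlo : ⌊τ n - max C 0 * n⌋₊ < mixingTime (d n) ε := by
    by_contra hle
    have := hdn (not_lt.1 hle)
    linarith [hn.1]
  have hlo' : τ n - max C 0 * n < mixingTime (d n) ε := (Nat.floor_lt' (by omega)).1 hlo
  exact abs_le.2 ⟨by linarith, by linarith⟩

lemma LinearTransition.hasCutoff (hd : ∀ᶠ n in atTop, Antitone (d n))
    (h : LinearTransition d τ) (hτ : Tendsto (fun n => τ n / n) atTop atTop) : HasCutoff d := by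
  intro ε hε0 hε1
  obtain ⟨C, hC⟩ := h.abs_mixingTime_sub_le hd hτ hε0 hε1
  obtain ⟨D, hD⟩ := h.abs_mixingTime_sub_le hd hτ (sub_pos.2 hε1) (by linarith : 1 - ε < 1)
  have hσ := tendsto_div_atTop_of_abs_sub_le hτ hD
  have hlim : Tendsto (fun n => (C + D) * ((mixingTime (d n) (1 - ε) : ℝ) / n)⁻¹) atTop (𝓝 0) := by
    simpa using hσ.inv_tendsto_atTop.const_mul (C + D)
  rw [tendsto_iff_dist_tendsto_zero]
  refine squeeze_zero' (Eventually.of_forall fun n => dist_nonneg) ?_ hlim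
  filter_upwards [hC, hD, hσ.eventually_gt_atTop 0, eventually_gt_atTop 0] with n hCn hDn hσn h0
  have h0' : (0 : ℝ) < n := by exact_mod_cast h0
  have hpos : 0 < (mixingTime (d n) (1 - ε) : ℝ) := (div_pos_iff_of_pos_right h0').1 hσn
  rw [Real.dist_eq, div_sub_one hpos.ne', abs_div, abs_of_pos hpos, inv_div, ← mul_div_assoc]
  refine div_le_div_of_nonneg_right ?_ hpos.le
  have h1 := abs_le.1 hCn
  have h2 := abs_le.1 hDn
  exact abs_le.2 ⟨by linarith, by linarith⟩

end Abstract

/-! ### The transition of the Metropolis chain -/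

/-- The location of the cutoff. -/
def cutoffTime (n : ℕ) (θ : ℝ) : ℝ :=
  2 / (1 + θ) * (n : ℝ) * min (Real.log (n : ℝ)) (Real.log (√((n : ℝ) / θ)))

lemma log_sqrt_div (hn : 0 < n) (hθ : 0 < θ) :
    Real.log (√((n : ℝ) / θ)) = (Real.log n - Real.log θ) / 2 := by
  have hn' : (0 : ℝ) < n := by exact_mod_cast hn
  rw [Real.log_sqrt (by positivity), Real.log_div hn'.ne' hθ.ne']

lemma half_log_le_cutoffTime_div (hn : 0 < n) (hθ : 0 < θ) (hθ1 : θ ≤ 1) :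
    1 / 2 * Real.log n ≤ cutoffTime n θ / n := by
  have hn' : (0 : ℝ) < n := by exact_mod_cast hn
  have hlog : 0 ≤ Real.log n := Real.log_nonneg (by exact_mod_cast hn)
  have hlogθ : Real.log θ ≤ 0 := Real.log_nonpos hθ.le hθ1
  have hmin : 1 / 2 * Real.log n ≤ min (Real.log (n : ℝ)) (Real.log (√((n : ℝ) / θ))) := by
    rw [log_sqrt_div hn hθ]
    exact le_min (by linarith) (by linarith)
  have h2 : 1 ≤ 2 / (1 + θ) := by rw [le_div_iff₀ (by positivity)]; linarith
  have : cutoffTime n θ / n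
      = 2 / (1 + θ) * min (Real.log (n : ℝ)) (Real.log (√((n : ℝ) / θ))) := by
    unfold cutoffTime; field_simp
  rw [this]
  nlinarith

/-- The exponent `(1 + θ) t / (2 n)` of the relaxation at `α n` past the cutoff time. -/
lemma cutoffTime_add_mul (hn : 0 < n) (hθ : 0 < θ) (α : ℝ) :
    (cutoffTime n θ + α * n) * ((1 + θ) / (2 * n))
      = min (Real.log (n : ℝ)) (Real.log (√((n : ℝ) / θ))) + α * (1 + θ) / 2 := by
  have hn' : (n : ℝ) ≠ 0 := by positivity
  have : 1 + θ ≠ 0 := by positivity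
  unfold cutoffTime
  field_simp

/-- The contraction bound gives mixing at `log n`, the `L²` bound at `log √(n/θ)`. -/
lemma erDist_floor_add_le (hn : 0 < n) (hθ : 0 < θ) (hθ1 : θ ≤ 1) {α : ℝ} (hα : 0 ≤ α) :
    erDist n θ ⌊cutoffTime n θ + α * n⌋₊
      ≤ √(Real.exp (Real.exp (1 - α / 2) ^ 2) - 1) := by
  have hn' : (0 : ℝ) < n := by exact_mod_cast hn
  have hn1 : (1 : ℝ) ≤ n := by exact_mod_cast hn
  set t := ⌊cutoffTime n θ + α * n⌋₊
  set m := min (Real.log (n : ℝ)) (Real.log (√((n : ℝ) / θ)))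
  have hu : (1 + θ) / (2 * n) ≤ 1 := by rw [div_le_one (by positivity)]; linarith
  have ht : m + α / 2 - 1 ≤ t * ((1 + θ) / (2 * n)) := by
    have h1 : cutoffTime n θ + α * n ≤ t + 1 := (Nat.lt_floor_add_one _).le
    have h2 := mul_le_mul_of_nonneg_right h1 (by positivity : 0 ≤ (1 + θ) / (2 * n))
    rw [cutoffTime_add_mul hn hθ] at h2
    nlinarith [mul_nonneg hα hθ.le]
  rcases min_choice (Real.log (n : ℝ)) (Real.log (√((n : ℝ) / θ))) with hm | hm
  · have h1 : erDist n θ t ≤ Real.exp (1 - α / 2) := by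
      calc erDist n θ t ≤ n * modeEigenvalue n θ 1 ^ t :=
            erDist_le_mul_modeEigenvalue_pow hn hθ hθ1 t
        _ ≤ Real.exp (Real.log n) * Real.exp (-((1 + θ) * (1 : ℕ) * t / (2 * n))) := by
            rw [Real.exp_log hn']
            exact mul_le_mul_of_nonneg_left (modeEigenvalue_pow_le_exp hθ1 hn t) hn'.le
        _ ≤ Real.exp (1 - α / 2) := by
            rw [← Real.exp_add, Real.exp_le_exp]
            have h2 : (1 + θ) * ((1 : ℕ) : ℝ) * t / (2 * n) = t * ((1 + θ) / (2 * n)) := by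
              push_cast; ring
            have h3 : m = Real.log n := hm
            rw [h2]; linarith
    refine h1.trans (Real.le_sqrt_of_sq_le ?_)
    linarith [Real.add_one_le_exp (Real.exp (1 - α / 2) ^ 2)]
  · refine (erDist_le_sqrt hθ hθ1 t).trans (Real.sqrt_le_sqrt (sub_le_sub_right ?_ 1))
    rw [Real.exp_le_exp]
    have h1 : (n : ℝ) / θ = Real.exp (Real.log n - Real.log θ) := by
      rw [Real.exp_sub, Real.exp_log hn', Real.exp_log hθ]
    rw [h1, ← Real.exp_add, ← Real.exp_nat_mul, Real.exp_le_exp]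
    have h2 : (1 + θ) * t / n = 2 * (t * ((1 + θ) / (2 * n))) := by field_simp
    have h3 : m = (Real.log n - Real.log θ) / 2 := hm.trans (log_sqrt_div hn hθ)
    rw [h2]; push_cast; linarith

lemma exp_le_modeEigenvalue_pow (hn : 2 ≤ n) (hθ : 0 < θ) (hθ1 : θ ≤ 1) (t : ℕ)
    (ht : t * ((1 + θ) / (2 * n)) ≤ Real.log n) :
    Real.exp (-(t * ((1 + θ) / (2 * n))) - 1) ≤ modeEigenvalue n θ 1 ^ t := by
  have hn2 : (2 : ℝ) ≤ n := by exact_mod_cast hn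
  set u := (1 + θ) / (2 * n)
  have hu0 : 0 < u := by positivity
  have hun : u * n ≤ 1 := by
    have : u * n = (1 + θ) / 2 := by simp only [u]; field_simp
    rw [this]; linarith
  have hu : u ≤ 1 / 2 := by nlinarith
  have hlam : modeEigenvalue n θ 1 = 1 - u := by
    simp only [modeEigenvalue, u]; push_cast; ring
  have hexp : Real.exp (-u - 2 * u ^ 2) ≤ 1 - u := by
    rw [← Real.le_log_iff_exp_le (by linarith)]
    refine le_trans ?_ (Real.one_sub_inv_le_log_of_pos (by linarith))
    have : (1 - u)⁻¹ ≤ 1 + u + 2 * u ^ 2 := by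
      rw [inv_le_iff_one_le_mul₀ (by linarith)]
      nlinarith [mul_nonneg (sq_nonneg u) (by linarith : 0 ≤ 1 - 2 * u)]
    linarith
  -- the second-order correction `2 t u ^ 2` is at most `2 log n / n`, hence at most one
  have hlog : Real.log n ≤ n / 2 := by
    have h1 := Real.log_le_sub_one_of_pos (by positivity : (0 : ℝ) < n / 2)
    rw [Real.log_div (by positivity) two_ne_zero] at h1
    have h2 := Real.log_le_sub_one_of_pos (two_pos : (0 : ℝ) < 2)
    linarith
  calc Real.exp (-(t * u) - 1) ≤ Real.exp (-u - 2 * u ^ 2) ^ t := by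
        rw [← Real.exp_nat_mul, Real.exp_le_exp]
        nlinarith [mul_le_mul_of_nonneg_right (ht.trans hlog) hu0.le]
    _ ≤ modeEigenvalue n θ 1 ^ t := by
        rw [hlam]; exact pow_le_pow_left₀ (Real.exp_pos _).le hexp t

lemma le_erDist_floor_sub (hn : 2 ≤ n) (hθ : 0 < θ) (hθ1 : θ ≤ 1) {α : ℝ} (hα : 0 ≤ α)
    (hαn : 0 ≤ cutoffTime n θ - α * n) :
    1 - (8 * Real.exp (1 - α / 2) ^ 2 + 4 * Real.exp (1 - α / 2))
      ≤ erDist n θ ⌊cutoffTime n θ - α * n⌋₊ := by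
  have hn0 : 0 < n := by omega
  have hn' : (0 : ℝ) < n := by exact_mod_cast hn0
  have hn2 : (2 : ℝ) ≤ n := by exact_mod_cast hn
  set t := ⌊cutoffTime n θ - α * n⌋₊
  set m := min (Real.log (n : ℝ)) (Real.log (√((n : ℝ) / θ)))
  have ht : t * ((1 + θ) / (2 * n)) ≤ m - α / 2 := by
    have h2 := mul_le_mul_of_nonneg_right (Nat.floor_le hαn)
      (by positivity : 0 ≤ (1 + θ) / (2 * n))
    have h3 := cutoffTime_add_mul hn0 hθ (-α)
    rw [neg_mul, ← sub_eq_add_neg] at h3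
    rw [h3] at h2
    nlinarith [mul_nonneg hα hθ.le]
  have hm1 : m ≤ Real.log n := min_le_left _ _
  have hm2 : m ≤ (Real.log n - Real.log θ) / 2 :=
    (min_le_right _ _).trans (log_sqrt_div hn0 hθ).le
  have hpow := exp_le_modeEigenvalue_pow hn hθ hθ1 t (by linarith)
  have hpos : 0 < modeEigenvalue n θ 1 := by
    have : (1 + θ) / (2 * (n : ℝ)) < 1 := by rw [div_lt_one (by positivity)]; linarith
    simpa [modeEigenvalue] using this
  refine le_trans ?_ (le_erDist hn0 hθ hθ1 t hpos)
  set D := n * modeEigenvalue n θ 1 ^ t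
  have hD : Real.exp (Real.log n - m + (α / 2 - 1)) ≤ D := by
    calc _ ≤ Real.exp (Real.log n) * Real.exp (-(t * ((1 + θ) / (2 * n))) - 1) := by
          rw [← Real.exp_add, Real.exp_le_exp]; linarith
      _ ≤ D := by
          rw [Real.exp_log hn']; exact mul_le_mul_of_nonneg_left hpow hn'.le
  have hD0 : 0 < D := (Real.exp_pos _).trans_le hD
  set s := Real.exp (1 - α / 2)
  have hs : 0 < s := Real.exp_pos _
  have hD1 : 1 ≤ s * D := by
    calc (1 : ℝ) ≤ s * Real.exp (Real.log n - m + (α / 2 - 1)) := by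
          rw [← Real.exp_add, Real.one_le_exp_iff]; linarith
      _ ≤ s * D := by gcongr
  have hD2 : n * θ ≤ s ^ 2 * D ^ 2 := by
    calc n * θ = Real.exp (Real.log n + Real.log θ) := by
          rw [Real.exp_add, Real.exp_log hn', Real.exp_log hθ]
      _ ≤ (s * Real.exp (Real.log n - m + (α / 2 - 1))) ^ 2 := by
          rw [← Real.exp_add, ← Real.exp_nat_mul, Real.exp_le_exp]; push_cast; linarith
      _ ≤ (s * D) ^ 2 := by gcongr
      _ = _ := by ring
  have : 4 * (2 * n * θ + D) / D ^ 2 ≤ 8 * s ^ 2 + 4 * s := by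
    rw [div_le_iff₀ (by positivity)]
    nlinarith [mul_le_mul_of_nonneg_right hD1 hD0.le]
  linarith

lemma tendsto_cutoffTime_div {θ : ℕ → ℝ} (hθ : ∀ n, 1 ≤ n → 0 < θ n ∧ θ n ≤ 1) :
    Tendsto (fun n : ℕ => cutoffTime n (θ n) / n) atTop atTop := by
  refine tendsto_atTop_mono' _ ?_
    ((Real.tendsto_log_atTop.comp tendsto_natCast_atTop_atTop).const_mul_atTop
      (by norm_num : (0 : ℝ) < 1 / 2))
  filter_upwards [eventually_ge_atTop 1] with n hn
  exact half_log_le_cutoffTime_div hn (hθ n hn).1 (hθ n hn).2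

lemma linearTransition_erDist {θ : ℕ → ℝ} (hθ : ∀ n, 1 ≤ n → 0 < θ n ∧ θ n ≤ 1) :
    LinearTransition (fun n => erDist n (θ n)) (fun n => cutoffTime n (θ n)) := by
  intro ε hε
  have hs : Tendsto (fun α : ℝ => Real.exp (1 - α / 2)) atTop (𝓝 0) := by
    refine Real.tendsto_exp_atBot.comp ?_
    have : Tendsto (fun α : ℝ => α / 2) atTop atTop := tendsto_id.atTop_div_const two_pos
    simpa [sub_eq_add_neg] using
      tendsto_atBot_add_const_left _ (1 : ℝ) (tendsto_neg_atTop_atBot.comp this)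
  have h1 : Tendsto (fun α : ℝ => √(Real.exp (Real.exp (1 - α / 2) ^ 2) - 1)) atTop (𝓝 0) := by
    have hc : Continuous fun s : ℝ => √(Real.exp (s ^ 2) - 1) := by fun_prop
    simpa [Function.comp_def] using (hc.tendsto 0).comp hs
  have h2 : Tendsto (fun α : ℝ => 8 * Real.exp (1 - α / 2) ^ 2 + 4 * Real.exp (1 - α / 2))
      atTop (𝓝 0) := by
    have hc : Continuous fun s : ℝ => 8 * s ^ 2 + 4 * s := by fun_prop
    simpa [Function.comp_def] using (hc.tendsto 0).comp hs
  obtain ⟨α, hα1, hα2, hα0⟩ := ((h1.eventually_lt_const hε).and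
    ((h2.eventually_lt_const hε).and (eventually_ge_atTop 0))).exists
  refine ⟨α, ?_⟩
  filter_upwards [eventually_ge_atTop 2, (tendsto_cutoffTime_div hθ).eventually_ge_atTop α]
    with n hn hτ
  obtain ⟨hθ0, hθ1⟩ := hθ n (by omega)
  have hn' : (0 : ℝ) < n := by exact_mod_cast (by omega : 0 < n)
  rw [le_div_iff₀ hn'] at hτ
  have hlo := le_erDist_floor_sub hn hθ0 hθ1 hα0 (sub_nonneg.2 hτ)
  have hup := erDist_floor_add_le (by omega) hθ0 hθ1 hα0 (n := n)
  exact ⟨by linarith, by linarith⟩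

end MetropolisCutoff

end

theorem theorem2 (θ : ℕ → ℝ) (hθ : ∀ n, 1 ≤ n → 0 < θ n ∧ θ n ≤ 1) :
    MetropolisCutoff.HasCutoff (fun n => MetropolisCutoff.erDist n (θ n)) ∧
    MetropolisCutoff.HasCutoffWindow (fun n => MetropolisCutoff.erDist n (θ n))
      (fun n => (MetropolisCutoff.mixingTime (MetropolisCutoff.erDist n (θ n)) (1 / 4) : ℝ))
      (fun n => (n : ℝ)) ∧
    MetropolisCutoff.HasCutoffWindow (fun n => MetropolisCutoff.erDist n (θ n))
      (fun n => 2 / (1 + θ n) * (n : ℝ) *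
        min (Real.log (n : ℝ)) (Real.log (Real.sqrt ((n : ℝ) / θ n))))
      (fun n => (n : ℝ)) := by
  have hd : ∀ᶠ n in atTop, Antitone (MetropolisCutoff.erDist n (θ n)) := by
    filter_upwards [eventually_ge_atTop 1] with n hn
    exact MetropolisCutoff.erDist_antitone (hθ n hn).1 (hθ n hn).2
  have hd0 : ∀ᶠ n in atTop, ∀ t, 0 ≤ MetropolisCutoff.erDist n (θ n) t :=
    Eventually.of_forall fun n t => MetropolisCutoff.erDist_nonneg t
  have hd1 : ∀ᶠ n in atTop, ∀ t, MetropolisCutoff.erDist n (θ n) t ≤ 1 := by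
    filter_upwards [eventually_ge_atTop 1] with n hn
    exact MetropolisCutoff.erDist_le_one (hθ n hn).1 (hθ n hn).2
  have hlt := MetropolisCutoff.linearTransition_erDist hθ
  have hτ := MetropolisCutoff.tendsto_cutoffTime_div hθ
  obtain ⟨C, hC⟩ := hlt.abs_mixingTime_sub_le hd hτ
    (by norm_num : (0 : ℝ) < 1 / 4) (by norm_num)
  exact ⟨hlt.hasCutoff hd hτ,
    (hlt.congr hd hC).hasCutoffWindow hd hd0 hd1
      (MetropolisCutoff.tendsto_div_atTop_of_abs_sub_le hτ hC),
    hlt.hasCutoffWindow hd hd0 hd1 hτ⟩
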